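/- Let $d\ge 1$ and let $Y=\{Y_s\}_{s\ge 0}$ be a stochastic process in $\mathbb R^d$ with $Y_0=0$ a.s. (the displacement process). For $\lambda\in(0,\infty)$ and a compact set $B\subset\mathbb R^d$ with non-empty interior, let $\Xi=\sum_{j\in\mathbb Z}\delta_{\xi_j}$ be a homogeneous Poisson process on $\mathbb R^d$ with rate $\lambda$, let $Y^{(j)}$, $j\in\mathbb Z$, be independent copies of the process $Y$, with $(Y^{(j)})_j$ independent of $(\xi_j)_j$, and let $$N_\rho(s)=\sum_{j\in\mathbb Z}\mathbf 1\{\xi_j+Y^{(j)}_s\in B\},\quad s\ge 0,\qquad \rho=\lambda\,\mathrm{vol}(B),$$ be the associated Smoluchowski process. For $n\ge1$, $t_1,\dots,t_n\in[0,\infty)$ and $\emptyset\ne\pi\subseteq\{1,\dots,n\}$ put $$U_\pi(t_1,\dots,t_n)=\frac1{\mathrm{vol}(B)}\sum_{\pi'\supseteq\pi}\int_{\mathbb R^d}\mathbb P\{x+Y_{t_k}\in B\ \forall k\in\pi',\ x+Y_{t_k}\notin B\ \forall k\notin\pi'\}\,dx ,$$ and let $\Sigma_H$ be the $n\times n$ matrix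 with entries $[\Sigma_H]_{i,j}=U(t_i,t_j):=U_{\{i,j\}}(t_1,\dots,t_n)$. Then, for every $n\ge 1$ and all $t_1,\dots,t_n\ge 0$ (in any order, repetitions allowed), the counts $N_\rho(s)$ are almost surely finite, and, with $e_n=(1,\dots,1)$, the following holds along any family of pairs $(\lambda,B)$ (the law of $Y$ being fixed) with $\rho=\lambda\,\mathrm{vol}(B)\to\infty$. 1. If $B$ is fixed (so that $\lambda\to\infty$), then $\Sigma_H$ is positive semidefinite and $$\frac{(N_\rho(t_1),\dots,N_\rho(t_n))-\rho e_n}{\sqrt\rho}\ \xrightarrow{\ d\ }\ \mathcal N_n(0,\Sigma_H).$$ 2. If $B$ varies with the family (for example $\mathrm{vol}(B)\to\infty$), so that $\Sigma_H$ depends on $B$, and $\Sigma_H\to S$ entrywise for some matrix $S$, then $S$ is positive semidefinite and $$\frac{(N_\rho(t_1),\dots,N_\rho(t_n))-\rho e_n}{\sqrt\rho}\ \xrightarrow{\ d\ }\ \mathcal N_n(0,S).$$ -/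

import Mathlib

open MeasureTheory ProbabilityTheory Filter Topology
open scoped NNReal ENNReal

noncomputable section

namespace Smoluchowski

/-- The point process `Ξ = ∑ j, δ_{ξ j}` on `ℝ^d` carried by a sequence of random points. -/
def pointProcess {d : ℕ} {Ω : Type*} (ξ : ℤ → Ω → EuclideanSpace ℝ (Fin d)) (ω : Ω) :
    Measure (EuclideanSpace ℝ (Fin d)) :=
  Measure.sum fun j => Measure.dirac (ξ j ω)

/-- `Ξ = ∑ j, δ_{ξ j}` is a homogeneous Poisson process on `ℝ^d` with rate `lam`: the number of
points in a Borel set `A` of finite volume is Poisson with mean `lam * vol A`, and the numbers of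
points in pairwise disjoint Borel sets are independent. -/
structure IsHomogeneousPoisson {d : ℕ} {Ω : Type*} [MeasurableSpace Ω] (P : Measure Ω)
    (lam : ℝ≥0) (ξ : ℤ → Ω → EuclideanSpace ℝ (Fin d)) : Prop where
  measurable_point : ∀ j, Measurable (ξ j)
  map_count : ∀ A : Set (EuclideanSpace ℝ (Fin d)), MeasurableSet A → volume A < ∞ →
    P.map (fun ω => pointProcess ξ ω A) =
      (poissonMeasure (lam * (volume A).toNNReal)).map (fun m : ℕ => (m : ℝ≥0∞))
  indep_count : ∀ (m : ℕ) (A : Fin m → Set (EuclideanSpace ℝ (Fin d))),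
    (∀ i, MeasurableSet (A i)) → Pairwise (fun i i' => Disjoint (A i) (A i')) →
    iIndepFun (fun i ω => pointProcess ξ ω (A i)) P

/-- A displacement process: an `ℝ^d`-valued process `Y_s`, `s ≥ 0`, with `Y_0 = 0`. -/
structure IsDisplacement {d : ℕ} {Ω' : Type*} [MeasurableSpace Ω'] (P' : Measure Ω')
    (Y : ℝ≥0 → Ω' → EuclideanSpace ℝ (Fin d)) : Prop where
  measurable : ∀ s, Measurable (Y s)
  zero : ∀ᵐ ω ∂P', Y 0 ω = 0

/-- The moving particle model: the initial positions `ξ j` form a homogeneous Poisson process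
with rate `lam`, the displacements `Z j` of the particles are independent copies (as random
elements of the path space) of the generic displacement process `Y`, and the initial positions are
independent of the displacements. -/
structure IsParticleSystem {d : ℕ} {Ω Ω' : Type*} [MeasurableSpace Ω] [MeasurableSpace Ω']
    (P : Measure Ω) (lam : ℝ≥0) (ξ : ℤ → Ω → EuclideanSpace ℝ (Fin d))
    (Z : ℤ → ℝ≥0 → Ω → EuclideanSpace ℝ (Fin d))
    (P' : Measure Ω') (Y : ℝ≥0 → Ω' → EuclideanSpace ℝ (Fin d)) : Prop where
  poisson : IsHomogeneousPoisson P lam ξ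
  measurable_displacement : ∀ j s, Measurable (Z j s)
  identDistrib : ∀ j, IdentDistrib (fun ω s => Z j s ω) (fun ω s => Y s ω) P P'
  iIndep : iIndepFun (fun j ω s => Z j s ω) P
  indep : IndepFun (fun ω j => ξ j ω) (fun ω j s => Z j s ω) P

/-- The Smoluchowski process `N(s) = ∑ j, 1{ξ j + Z j s ∈ B}`, with values in `[0, ∞]`. -/
def count {d : ℕ} {Ω : Type*} (B : Set (EuclideanSpace ℝ (Fin d)))
    (ξ : ℤ → Ω → EuclideanSpace ℝ (Fin d)) (Z : ℤ → ℝ≥0 → Ω → EuclideanSpace ℝ (Fin d))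
    (s : ℝ≥0) (ω : Ω) : ℝ≥0∞ :=
  ∑' j : ℤ, B.indicator 1 (ξ j ω + Z j s ω)

/-- `ρ = lam * vol B`. -/
def rho {d : ℕ} (lam : ℝ≥0) (B : Set (EuclideanSpace ℝ (Fin d))) : ℝ :=
  lam * volume.real B

/-- The normalized vector `((N(t 1), …, N(t n)) - ρ (1, …, 1)) / √ρ`. -/
def normalizedCount {d n : ℕ} {Ω : Type*} (lam : ℝ≥0) (B : Set (EuclideanSpace ℝ (Fin d)))
    (ξ : ℤ → Ω → EuclideanSpace ℝ (Fin d)) (Z : ℤ → ℝ≥0 → Ω → EuclideanSpace ℝ (Fin d))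
    (t : Fin n → ℝ≥0) (ω : Ω) : EuclideanSpace ℝ (Fin n) :=
  WithLp.toLp 2 fun k => ((count B ξ Z (t k) ω).toReal - rho lam B) / √(rho lam B)

/-- `Q_π(x; t)`: the probability that a particle started at `x` is in `B` at exactly those of the
times `t k` for which `k ∈ π`. -/
def Q {d n : ℕ} {Ω' : Type*} [MeasurableSpace Ω'] (P' : Measure Ω')
    (Y : ℝ≥0 → Ω' → EuclideanSpace ℝ (Fin d)) (B : Set (EuclideanSpace ℝ (Fin d)))
    (t : Fin n → ℝ≥0) (π : Finset (Fin n)) (x : EuclideanSpace ℝ (Fin d)) : ℝ :=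
  P'.real {ω | (∀ k ∈ π, x + Y (t k) ω ∈ B) ∧ ∀ k ∉ π, x + Y (t k) ω ∉ B}

/-- `Q̄_π(t) = ∫ Q_π(x; t) dx`. -/
def Qbar {d n : ℕ} {Ω' : Type*} [MeasurableSpace Ω'] (P' : Measure Ω')
    (Y : ℝ≥0 → Ω' → EuclideanSpace ℝ (Fin d)) (B : Set (EuclideanSpace ℝ (Fin d)))
    (t : Fin n → ℝ≥0) (π : Finset (Fin n)) : ℝ :=
  ∫ x, Q P' Y B t π x

/-- `U_π(t) = (1 / vol B) ∑_{π' ⊇ π} Q̄_{π'}(t)`, for non-empty `π`. -/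
def U {d n : ℕ} {Ω' : Type*} [MeasurableSpace Ω'] (P' : Measure Ω')
    (Y : ℝ≥0 → Ω' → EuclideanSpace ℝ (Fin d)) (B : Set (EuclideanSpace ℝ (Fin d)))
    (t : Fin n → ℝ≥0) (π : Finset (Fin n)) : ℝ :=
  1 / volume.real B * ∑ π' with π ⊆ π', Qbar P' Y B t π'

/-- The matrix `Σ_H` with entries `U_{{i, j}}(t)`. -/
def sigmaH {d n : ℕ} {Ω' : Type*} [MeasurableSpace Ω'] (P' : Measure Ω')
    (Y : ℝ≥0 → Ω' → EuclideanSpace ℝ (Fin d)) (B : Set (EuclideanSpace ℝ (Fin d)))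
    (t : Fin n → ℝ≥0) : Matrix (Fin n) (Fin n) ℝ :=
  Matrix.of fun i j => U P' Y B t {i, j}

end Smoluchowski

end

namespace Smoluchowski

/-! Attach to each starting point the displacements of its particle at the times `t k`. The marked
points behave like a Poisson process on `ℝ^d × (ℝ^d)^n` with intensity `lam • volume.prod ν`, where
`ν` is the law of the displacements, and the count at time `t k` is the number of marked points in
`hitSet B k`. Hence the joint characteristic function is explicit: `E exp(i ∑ a k N(t k)) = exp(lam
∫ (exp(i W) - 1))` with `W = weightedHits B a` (`IsParticleSystem.integral_exp_count`).

By translation invariance `∫ W = vol B * ∑ a k`, and sorting particles by their visit pattern gives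
`∫ W ^ 2 = vol B * aᵀ Σ_H a`. With `a = θ / √ρ` and a second-order Taylor expansion, the linear term
is cancelled by the centering, the quadratic term is `-θᵀ Σ_H θ / 2`, and the remainder is
`O(ρ^(-1/2))` with constants depending on `θ` alone (`IsParticleSystem.charFun_normalizedCount`).
This uniformity in `B` handles varying regions, and a fixed region is the case of constant `Σ_H`.
Lévy's theorem concludes.

The generating functional comes from the counts: for simple functions by independence over level
sets, then by `L¹` approximation with Campbell's formula controlling the error. Marks are averaged
out by Fubini. -/

/-! ### Preliminaries: moments of the Poisson law, comparison of products. -/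

theorem lintegral_natCast_poissonMeasure (r : ℝ≥0) :
    ∫⁻ m : ℕ, (m : ℝ≥0∞) ∂(poissonMeasure r) = r := by
  have hs : HasSum (fun n : ℕ => Real.exp (-r) * (r : ℝ) ^ n / n.factorial * n) (r : ℝ) := by
    rw [← hasSum_nat_add_iff' 1]
    have h := (hasSum_one_poissonMeasure r).mul_left (r : ℝ)
    simp only [mul_one] at h
    convert! h using 1
    · ext n
      rw [Nat.factorial_succ]
      have : (n.factorial : ℝ) ≠ 0 := by positivity
      push_cast
      field_simp
      ring
    · simp
  rw [poissonMeasure, lintegral_sum_measure]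
  simp only [lintegral_smul_measure, lintegral_dirac, smul_eq_mul]
  have h2 : ∀ n : ℕ, ENNReal.ofReal (Real.exp (-r) * (r : ℝ) ^ n / n.factorial) * (n : ℝ≥0∞)
      = ENNReal.ofReal (Real.exp (-r) * (r : ℝ) ^ n / n.factorial * n) := fun n => by
    rw [ENNReal.ofReal_mul (by positivity), ENNReal.ofReal_natCast]
  simp_rw [h2]
  rw [← ENNReal.ofReal_tsum_of_nonneg (fun n => by positivity) hs.summable, hs.tsum_eq,
    ENNReal.ofReal_coe_nnreal]

theorem integral_pow_poissonMeasure (r : ℝ≥0) (z : ℂ) :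
    ∫ m : ℕ, z ^ m ∂(poissonMeasure r) = Complex.exp (r * (z - 1)) := by
  rw [integral_poissonMeasure]
  have h1 : ∀ n : ℕ, (Real.exp (-r) * (r : ℝ) ^ n / n.factorial) • z ^ n
      = Complex.exp (-r) * ((r * z) ^ n / n.factorial) := fun n => by
    rw [Complex.real_smul, mul_pow]
    push_cast
    ring
  simp_rw [h1]
  rw [tsum_mul_left, (NormedSpace.expSeries_div_hasSum_exp (r * z : ℂ)).tsum_eq,
    ← Complex.exp_eq_exp_ℂ, ← Complex.exp_add]
  ring_nf

/-- Telescoping; it makes the error in a product over particles additive, so that Campbell's formula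
applies. -/
theorem norm_prod_sub_prod_le {ι : Type*} (s : Finset ι) (a b : ι → ℂ) (ha : ∀ i, ‖a i‖ ≤ 1)
    (hb : ∀ i, ‖b i‖ ≤ 1) : ‖∏ i ∈ s, a i - ∏ i ∈ s, b i‖ ≤ ∑ i ∈ s, ‖a i - b i‖ := by
  classical
  induction s using Finset.induction_on with
  | empty => simp
  | insert i s hi ih =>
    rw [Finset.prod_insert hi, Finset.prod_insert hi, Finset.sum_insert hi]
    have hprod : ‖∏ i ∈ s, a i‖ ≤ 1 := by
      rw [norm_prod]
      exact Finset.prod_le_one (fun _ _ => norm_nonneg _) fun _ _ => ha _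
    calc ‖a i * ∏ i ∈ s, a i - b i * ∏ i ∈ s, b i‖
        = ‖(a i - b i) * ∏ i ∈ s, a i + b i * (∏ i ∈ s, a i - ∏ i ∈ s, b i)‖ := by ring_nf
      _ ≤ ‖a i - b i‖ * ‖∏ i ∈ s, a i‖ + ‖b i‖ * ‖∏ i ∈ s, a i - ∏ i ∈ s, b i‖ :=
        (norm_add_le _ _).trans (by rw [norm_mul, norm_mul])
      _ ≤ ‖a i - b i‖ * 1 + 1 * ∑ i ∈ s, ‖a i - b i‖ := by gcongr; exact hb i
      _ = _ := by ring

/-! ### Campbell's formula and the generating functional of a Poisson process. -/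

section Poisson

variable {d : ℕ} {Ω : Type*} {ξ : ℤ → Ω → EuclideanSpace ℝ (Fin d)}

theorem pointProcess_apply (ω : Ω) {A : Set (EuclideanSpace ℝ (Fin d))} (hA : MeasurableSet A) :
    pointProcess ξ ω A = ∑' j, A.indicator 1 (ξ j ω) := by
  rw [pointProcess, Measure.sum_apply _ hA]
  simp [Measure.dirac_apply' _ hA]

theorem pointProcess_apply_encard (ω : Ω) {A : Set (EuclideanSpace ℝ (Fin d))}
    (hA : MeasurableSet A) : pointProcess ξ ω A = ({j | ξ j ω ∈ A}.encard : ℝ≥0∞) := by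
  rw [pointProcess_apply ω hA, ← ENNReal.tsum_set_one,
    tsum_subtype {j | ξ j ω ∈ A} fun _ => (1 : ℝ≥0∞)]
  rfl

/-- Only finitely many points lie where `k ≠ 0`, and all other factors are `1`; the remaining ones
are grouped by the value of `k`. The value `0` is excluded because its level set may contain
infinitely many points. The floor of `toReal` reads the `ℝ≥0∞`-valued count as a natural number. -/
theorem eventually_prod_eq_prod_pow (k : SimpleFunc (EuclideanSpace ℝ (Fin d)) ℂ) (ω : Ω)
    (hω : ∀ c ∈ k.range.erase 0, pointProcess ξ ω (k ⁻¹' {c}) < ∞) :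
    ∀ᶠ s : Finset ℤ in atTop, ∏ j ∈ s, (1 + k (ξ j ω)) =
      ∏ c ∈ k.range.erase 0, (1 + c) ^ ⌊(pointProcess ξ ω (k ⁻¹' {c})).toReal⌋₊ := by
  classical
  have hfinc : ∀ c ∈ k.range.erase 0, {j | ξ j ω ∈ k ⁻¹' {c}}.Finite := fun c hc => by
    have := hω c hc
    rw [pointProcess_apply_encard ω (k.measurableSet_preimage _)] at this
    simpa using this
  have hT : {j | k (ξ j ω) ≠ 0}.Finite := by
    refine ((k.range.erase 0).finite_toSet.biUnion hfinc).subset fun j hj => ?_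
    simp only [Set.mem_iUnion, Set.mem_ofPred_eq, Set.mem_preimage, Set.mem_singleton_iff]
    exact ⟨_, by simpa using hj, rfl⟩
  filter_upwards [eventually_ge_atTop hT.toFinset] with s hs
  rw [← Finset.prod_subset hs (fun j _ hj => by
    have : k (ξ j ω) = 0 := by simpa using hj
    simp [this])]
  rw [← Finset.prod_fiberwise_of_maps_to (g := fun j => k (ξ j ω)) (t := k.range.erase 0)
    (fun j hj => by simpa using hj)]
  refine Finset.prod_congr rfl fun c hc => ?_
  rw [Finset.prod_congr rfl (g := fun _ => 1 + c) (fun j hj => by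
    rw [(Finset.mem_filter.1 hj).2]), Finset.prod_const]
  congr 1
  have hset : {j | ξ j ω ∈ k ⁻¹' {c}} = ((hT.toFinset.filter fun j => k (ξ j ω) = c : Finset ℤ) :
      Set ℤ) := by
    ext j
    simp only [Set.mem_preimage, Set.mem_singleton_iff, Set.mem_ofPred_eq, Finset.coe_filter,
      Set.Finite.mem_toFinset]
    exact ⟨fun h => ⟨h ▸ Finset.ne_of_mem_erase hc, h⟩, fun h => h.2⟩
  rw [pointProcess_apply_encard ω (k.measurableSet_preimage _), hset, Set.encard_coe_eq_coe_finsetCard]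
  simp

variable [MeasurableSpace Ω] {P : Measure Ω} {lam : ℝ≥0}

theorem IsHomogeneousPoisson.measurable_pointCount (h : IsHomogeneousPoisson P lam ξ)
    {A : Set (EuclideanSpace ℝ (Fin d))} (hA : MeasurableSet A) :
    Measurable fun ω => pointProcess ξ ω A := by
  simp_rw [pointProcess_apply _ hA]
  exact Measurable.tsum fun j =>
    (measurable_one.indicator hA).comp (h.measurable_point j)

theorem IsHomogeneousPoisson.lintegral_pointCount (h : IsHomogeneousPoisson P lam ξ)
    {A : Set (EuclideanSpace ℝ (Fin d))} (hA : MeasurableSet A) (hfin : volume A < ∞) :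
    ∫⁻ ω, pointProcess ξ ω A ∂P = lam * volume A := by
  have h1 := lintegral_map (μ := P) (f := fun x : ℝ≥0∞ => x) measurable_id
    (h.measurable_pointCount hA)
  rw [← h1, h.map_count A hA hfin, lintegral_map (f := fun x => x) measurable_id .of_discrete,
    lintegral_natCast_poissonMeasure]
  simp [ENNReal.coe_toNNReal hfin.ne]

/-- The mean counts identify the intensity measure on sets of finite volume; exhaustion by
`spanningSets` extends this to all Borel sets. -/
theorem IsHomogeneousPoisson.sum_map_eq (h : IsHomogeneousPoisson P lam ξ) :
    (Measure.sum fun j => P.map (ξ j)) = lam • volume := by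
  have key : ∀ A, MeasurableSet A → volume A < ∞ →
      (Measure.sum fun j => P.map (ξ j)) A = (lam • volume : Measure _) A := fun A hA hfin => by
    rw [Measure.smul_apply, ENNReal.smul_def, smul_eq_mul, ← h.lintegral_pointCount hA hfin,
      Measure.sum_apply _ hA]
    simp_rw [pointProcess_apply _ hA]
    rw [lintegral_tsum (f := fun j ω => A.indicator (1 : EuclideanSpace ℝ (Fin d) → ℝ≥0∞) (ξ j ω)) fun j =>
      ((measurable_one.indicator hA).comp (h.measurable_point j)).aemeasurable]
    congr 1 with j
    rw [Measure.map_apply (h.measurable_point j) hA]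
    have : (fun ω => A.indicator (1 : EuclideanSpace ℝ (Fin d) → ℝ≥0∞) (ξ j ω)) = (ξ j ⁻¹' A).indicator 1 := rfl
    rw [this, lintegral_indicator_one (h.measurable_point j hA)]
  ext A hA
  have hU : A = ⋃ n, A ∩ spanningSets volume n := by
    rw [← Set.inter_iUnion, iUnion_spanningSets, Set.inter_univ]
  have hmono : Monotone fun n => A ∩ spanningSets (volume : Measure (EuclideanSpace ℝ (Fin d))) n :=
    fun m n hmn => Set.inter_subset_inter_right _ (monotone_spanningSets _ hmn)
  rw [hU, hmono.measure_iUnion, hmono.measure_iUnion]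
  congr 1 with n
  exact key _ (hA.inter (measurableSet_spanningSets _ _))
    ((measure_mono Set.inter_subset_right).trans_lt (measure_spanningSets_lt_top _ _))

/-- Campbell's formula. -/
theorem IsHomogeneousPoisson.tsum_lintegral (h : IsHomogeneousPoisson P lam ξ)
    {f : EuclideanSpace ℝ (Fin d) → ℝ≥0∞} (hf : Measurable f) :
    ∑' j, ∫⁻ ω, f (ξ j ω) ∂P = lam * ∫⁻ x, f x := by
  have h1 : ∫⁻ x, f x ∂(Measure.sum fun j => P.map (ξ j)) = ∑' j, ∫⁻ ω, f (ξ j ω) ∂P := by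
    rw [lintegral_sum_measure]
    congr 1 with j
    rw [lintegral_map hf (h.measurable_point j)]
  rw [← h1, h.sum_map_eq, lintegral_smul_measure, ENNReal.smul_def, smul_eq_mul]

theorem IsHomogeneousPoisson.ae_pointCount_lt_top (h : IsHomogeneousPoisson P lam ξ)
    {A : Set (EuclideanSpace ℝ (Fin d))} (hA : MeasurableSet A) (hfin : volume A < ∞) :
    ∀ᵐ ω ∂P, pointProcess ξ ω A < ∞ := by
  refine ae_lt_top (h.measurable_pointCount hA) ?_
  rw [h.lintegral_pointCount hA hfin]
  exact ENNReal.mul_ne_top ENNReal.coe_ne_top hfin.ne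

theorem measurable_pow_floor (z : ℂ) : Measurable fun x : ℝ≥0∞ => z ^ ⌊x.toReal⌋₊ :=
  (measurable_from_nat (f := fun m => z ^ m)).comp
    (Nat.measurable_floor.comp ENNReal.measurable_toReal)

theorem IsHomogeneousPoisson.integral_pow (h : IsHomogeneousPoisson P lam ξ)
    {A : Set (EuclideanSpace ℝ (Fin d))} (hA : MeasurableSet A) (hfin : volume A < ∞) (z : ℂ) :
    ∫ ω, z ^ ⌊(pointProcess ξ ω A).toReal⌋₊ ∂P =
      Complex.exp (lam * volume.real A * (z - 1)) := by
  have h1 := integral_map (μ := P) (h.measurable_pointCount hA).aemeasurable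
    (measurable_pow_floor z).aestronglyMeasurable
  rw [← h1, h.map_count A hA hfin, integral_map .of_discrete
    (measurable_pow_floor z).aestronglyMeasurable]
  simp only [ENNReal.toReal_natCast, Nat.floor_natCast]
  rw [integral_pow_poissonMeasure]
  simp [Measure.real, ENNReal.toReal]

/-- Level sets of `k` are disjoint, so the expectation factors into Poisson generating functions at
`1 + c`, whose exponents add up to `lam * ∫ k`. -/
theorem IsHomogeneousPoisson.integral_prod_pow (h : IsHomogeneousPoisson P lam ξ)
    (k : SimpleFunc (EuclideanSpace ℝ (Fin d)) ℂ) (hk : Integrable k volume) :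
    ∫ ω, ∏ c ∈ k.range.erase 0, (1 + c) ^ ⌊(pointProcess ξ ω (k ⁻¹' {c})).toReal⌋₊ ∂P =
      Complex.exp (lam * ∫ x, k x) := by
  classical
  set R := k.range.erase 0 with hR
  have hind := h.indep_count R.card (fun i => k ⁻¹' {(R.equivFin.symm i : ℂ)})
    (fun i => k.measurableSet_preimage _) (fun i i' hii' => by
      refine Set.disjoint_left.2 fun x hx hx' => hii' ?_
      simp only [Set.mem_preimage, Set.mem_singleton_iff] at hx hx'
      exact R.equivFin.symm.injective (Subtype.ext (hx.symm.trans hx')))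
  have hprod := hind.integral_fun_prod_comp
    (f := fun i x => (1 + (R.equivFin.symm i : ℂ)) ^ ⌊x.toReal⌋₊)
    (fun i => (h.measurable_pointCount (k.measurableSet_preimage _)).aemeasurable)
    (fun i => (measurable_pow_floor _).aestronglyMeasurable)
  have hre : ∀ f : ℂ → ℂ, ∏ i, f (R.equivFin.symm i : ℂ) = ∏ c ∈ R, f c := fun f => by
    rw [← Finset.prod_coe_sort R, Equiv.prod_comp R.equivFin.symm (fun c : R => f c)]
  simp_rw [fun ω => hre (fun c => (1 + c) ^ ⌊(pointProcess ξ ω (k ⁻¹' {c})).toReal⌋₊)] at hprod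
  rw [hprod, hre (fun c => ∫ ω, (1 + c) ^ ⌊(pointProcess ξ ω (k ⁻¹' {c})).toReal⌋₊ ∂P)]
  have h0 : ∀ c ∈ R, ∫ ω, (1 + c) ^ ⌊(pointProcess ξ ω (k ⁻¹' {c})).toReal⌋₊ ∂P =
      Complex.exp (lam * (volume.real (k ⁻¹' {c}) • c)) := fun c hc => by
    rw [h.integral_pow (k.measurableSet_preimage _)
      (SimpleFunc.integrable_iff.1 hk c (Finset.ne_of_mem_erase hc)), Complex.real_smul]
    ring_nf
  rw [Finset.prod_congr rfl h0, ← Complex.exp_sum, ← Finset.mul_sum,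
    ← SimpleFunc.integral_eq_integral _ hk, SimpleFunc.integral_eq]
  congr 2
  exact Finset.sum_erase _ (by simp)

theorem IsHomogeneousPoisson.tendsto_integral_prod_simpleFunc [IsProbabilityMeasure P]
    (h : IsHomogeneousPoisson P lam ξ)
    (k : SimpleFunc (EuclideanSpace ℝ (Fin d)) ℂ) (hk : Integrable k volume)
    (hk1 : ∀ x, ‖1 + k x‖ ≤ 1) :
    Tendsto (fun s : Finset ℤ => ∫ ω, ∏ j ∈ s, (1 + k (ξ j ω)) ∂P) atTop
      (𝓝 (Complex.exp (lam * ∫ x, k x))) := by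
  rw [← h.integral_prod_pow k hk]
  refine tendsto_integral_filter_of_dominated_convergence (fun _ => 1) ?_ ?_ (integrable_const _) ?_
  · exact Eventually.of_forall fun s => (Finset.measurable_fun_prod _ fun j _ =>
      (k.measurable.comp (h.measurable_point j)).const_add 1).aestronglyMeasurable
  · refine Eventually.of_forall fun s => Eventually.of_forall fun ω => ?_
    rw [norm_prod]
    exact Finset.prod_le_one (fun _ _ => norm_nonneg _) fun _ _ => hk1 _
  · have : ∀ᵐ ω ∂P, ∀ c ∈ k.range.erase 0, pointProcess ξ ω (k ⁻¹' {c}) < ∞ :=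
      (ae_ball_iff (S := (k.range.erase 0 : Set ℂ)) (Finset.countable_toSet _)).2 fun c hc =>
        h.ae_pointCount_lt_top (k.measurableSet_preimage _)
          (SimpleFunc.integrable_iff.1 hk c (Finset.ne_of_mem_erase hc))
    filter_upwards [this] with ω hω
    exact tendsto_nhds_of_eventually_eq (eventually_prod_eq_prod_pow k ω hω)

/-- The bound does not depend on `s`: the telescoped sum is at most the sum over all points, which
Campbell's formula turns into an `L¹` distance. -/
theorem IsHomogeneousPoisson.norm_integral_prod_sub_le [IsProbabilityMeasure P]
    (h : IsHomogeneousPoisson P lam ξ) {f g : EuclideanSpace ℝ (Fin d) → ℂ} (hf : Measurable f)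
    (hg : Measurable g) (hf1 : ∀ x, ‖f x‖ ≤ 1) (hg1 : ∀ x, ‖g x‖ ≤ 1) {ε : ℝ≥0}
    (hfg : lam * ∫⁻ x, ‖f x - g x‖ₑ ≤ ε) (s : Finset ℤ) :
    ‖∫ ω, ∏ j ∈ s, f (ξ j ω) ∂P - ∫ ω, ∏ j ∈ s, g (ξ j ω) ∂P‖ ≤ ε := by
  have hint : ∀ u : EuclideanSpace ℝ (Fin d) → ℂ, Measurable u → (∀ x, ‖u x‖ ≤ 1) →
      Integrable (fun ω => ∏ j ∈ s, u (ξ j ω)) P := fun u hu hu1 => by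
    refine Integrable.of_bound (Finset.measurable_fun_prod _ fun j _ =>
      hu.comp (h.measurable_point j)).aestronglyMeasurable 1 (Eventually.of_forall fun ω => ?_)
    rw [norm_prod]
    exact Finset.prod_le_one (fun _ _ => norm_nonneg _) fun _ _ => hu1 _
  rw [← integral_sub (hint f hf hf1) (hint g hg hg1)]
  have h1 : ‖∫ ω, (∏ j ∈ s, f (ξ j ω) - ∏ j ∈ s, g (ξ j ω)) ∂P‖ₑ ≤ ε := by
    have hm : Measurable fun x => ‖f x - g x‖ₑ := (hf.sub hg).enorm
    calc _ ≤ ∫⁻ ω, ‖∏ j ∈ s, f (ξ j ω) - ∏ j ∈ s, g (ξ j ω)‖ₑ ∂P :=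
          enorm_integral_le_lintegral_enorm _
      _ ≤ ∫⁻ ω, ∑ j ∈ s, ‖f (ξ j ω) - g (ξ j ω)‖ₑ ∂P := by
          refine lintegral_mono fun ω => ?_
          simp only [← ofReal_norm]
          rw [← ENNReal.ofReal_sum_of_nonneg fun _ _ => norm_nonneg _]
          exact ENNReal.ofReal_le_ofReal
            (norm_prod_sub_prod_le s _ _ (fun _ => hf1 _) fun _ => hg1 _)
      _ = ∑ j ∈ s, ∫⁻ ω, ‖f (ξ j ω) - g (ξ j ω)‖ₑ ∂P :=
          lintegral_finsetSum _ fun j _ => hm.comp (h.measurable_point j)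
      _ ≤ ∑' j, ∫⁻ ω, ‖f (ξ j ω) - g (ξ j ω)‖ₑ ∂P := ENNReal.sum_le_tsum _
      _ = lam * ∫⁻ x, ‖f x - g x‖ₑ := h.tsum_lintegral hm
      _ ≤ ε := hfg
  rw [← ofReal_norm] at h1
  simpa using ENNReal.toReal_mono ENNReal.coe_ne_top h1

/-- The generating functional of a homogeneous Poisson process. -/
theorem IsHomogeneousPoisson.tendsto_integral_prod [IsProbabilityMeasure P]
    (h : IsHomogeneousPoisson P lam ξ) {g : EuclideanSpace ℝ (Fin d) → ℂ} (hg : Measurable g)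
    (hg1 : ∀ x, ‖g x‖ ≤ 1) (hint : Integrable (fun x => g x - 1) volume) :
    Tendsto (fun s : Finset ℤ => ∫ ω, ∏ j ∈ s, g (ξ j ω) ∂P) atTop
      (𝓝 (Complex.exp (lam * ∫ x, (g x - 1)))) := by
  -- Approximants of `g - 1` with values in this ball keep `‖1 + k n‖ ≤ 1`; the base value `0` makes
  -- them integrable.
  have h0 : (0 : ℂ) ∈ Metric.closedBall (-1 : ℂ) 1 := by simp
  have hm : Measurable fun x => g x - 1 := hg.sub_const 1
  have hmem : ∀ᵐ x, g x - 1 ∈ closure (Metric.closedBall (-1 : ℂ) 1) :=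
    Eventually.of_forall fun x => subset_closure (by simpa [dist_eq_norm] using hg1 x)
  set k := SimpleFunc.approxOn (fun x => g x - 1) hm (Metric.closedBall (-1 : ℂ) 1) 0 h0 with hk
  have hk1 : ∀ n x, ‖1 + k n x‖ ≤ 1 := fun n x => by
    have := SimpleFunc.approxOn_mem hm h0 n x
    rw [mem_closedBall_iff_norm] at this
    rwa [← hk, sub_neg_eq_add, add_comm] at this
  have hkint : ∀ n, Integrable (k n) volume :=
    SimpleFunc.integrable_approxOn hm hint h0 (integrable_zero _ _ _)
  have hL1 : Tendsto (fun n => ∫⁻ x, ‖k n x - (g x - 1)‖ₑ) atTop (𝓝 0) :=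
    SimpleFunc.tendsto_approxOn_L1_enorm hm h0 hmem (by simpa using hint.2)
  have hexp : Tendsto (fun n => Complex.exp (lam * ∫ x, k n x)) atTop
      (𝓝 (Complex.exp (lam * ∫ x, (g x - 1)))) :=
    (Complex.continuous_exp.tendsto _).comp ((tendsto_integral_of_L1 _ hint.1
      (Eventually.of_forall hkint) hL1).const_mul _)
  have hL2 : Tendsto (fun n => (lam : ℝ≥0∞) * ∫⁻ x, ‖k n x - (g x - 1)‖ₑ) atTop (𝓝 0) := by
    simpa using ENNReal.Tendsto.const_mul hL1 (Or.inr ENNReal.coe_ne_top)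
  rw [Metric.tendsto_nhds]
  intro ε hε
  have hε3 : (0 : ℝ≥0∞) < ((ε / 3).toNNReal : ℝ≥0) := by simpa using hε
  -- The approximation error is uniform in `s`, so `n` can be fixed before `s`.
  obtain ⟨n, hn1, hn2⟩ := ((Metric.tendsto_nhds.1 hexp (ε / 3) (by positivity)).and
    (hL2.eventually_lt_const hε3)).exists
  filter_upwards [Metric.tendsto_nhds.1 (h.tendsto_integral_prod_simpleFunc (k n) (hkint n) (hk1 n))
    (ε / 3) (by positivity)] with s hs
  have h3 := h.norm_integral_prod_sub_le ((k n).measurable.const_add 1) hg (hk1 n) hg1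
    (ε := (ε / 3).toNNReal) (by
      refine le_trans (le_of_eq ?_) hn2.le
      congr 2 with x
      ring_nf) s
  rw [← dist_eq_norm, Real.coe_toNNReal _ (by positivity), dist_comm] at h3
  calc _ ≤ _ := dist_triangle4 _ (∫ ω, ∏ j ∈ s, (1 + k n (ξ j ω)) ∂P)
        (Complex.exp (lam * ∫ x, k n x)) _
    _ < ε := by linarith

end Poisson

end Smoluchowski

namespace Smoluchowski

/-! ### Poisson processes with independent marks. -/

section Marked

variable {d : ℕ} {Ω : Type*} [MeasurableSpace Ω] {P : Measure Ω} [IsProbabilityMeasure P]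
  {lam : ℝ≥0} {ξ : ℤ → Ω → EuclideanSpace ℝ (Fin d)}
  {M : Type*} [MeasurableSpace M] {W : ℤ → Ω → M} {ν : Measure M} [IsProbabilityMeasure ν]

theorem IsHomogeneousPoisson.tsum_lintegral_marked (h : IsHomogeneousPoisson P lam ξ)
    (hW : ∀ j, Measurable (W j)) (hlaw : ∀ j, P.map (W j) = ν)
    (hind : IndepFun (fun ω j => ξ j ω) (fun ω j => W j ω) P)
    {f : EuclideanSpace ℝ (Fin d) × M → ℝ≥0∞} (hf : Measurable f) :
    ∑' j, ∫⁻ ω, f (ξ j ω, W j ω) ∂P = lam * ∫⁻ p, f p ∂(volume.prod ν) := by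
  rw [lintegral_prod _ hf.aemeasurable, ← h.tsum_lintegral hf.lintegral_prod_right']
  congr 1 with j
  have hj : IndepFun (ξ j) (W j) P :=
    hind.comp (φ := fun x : ℤ → EuclideanSpace ℝ (Fin d) => x j) (ψ := fun x : ℤ → M => x j)
      (measurable_pi_apply j) (measurable_pi_apply j)
  have h1 := lintegral_map (μ := P) hf ((h.measurable_point j).prodMk (hW j))
  rw [← h1, hj.map_prod_eq_prod_map_map (h.measurable_point j).aemeasurable (hW j).aemeasurable,
    hlaw, lintegral_prod _ hf.aemeasurable, lintegral_map hf.lintegral_prod_right'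
      (h.measurable_point j)]

/-- Conditionally on all positions the marks are still i.i.d. with law `ν`, so each factor may be
averaged separately. This reduces the marked functional to the unmarked one for `x ↦ ∫ F (x, w) ∂ν`.
-/
theorem integral_prod_marked (hξ : ∀ j, Measurable (ξ j))
    (hW : ∀ j, Measurable (W j)) (hlaw : ∀ j, P.map (W j) = ν) (hiind : iIndepFun W P)
    (hind : IndepFun (fun ω j => ξ j ω) (fun ω j => W j ω) P)
    {F : EuclideanSpace ℝ (Fin d) × M → ℂ} (hF : Measurable F) (hF1 : ∀ p, ‖F p‖ ≤ 1)
    (s : Finset ℤ) :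
    ∫ ω, ∏ j ∈ s, F (ξ j ω, W j ω) ∂P = ∫ ω, ∏ j ∈ s, ∫ w, F (ξ j ω, w) ∂ν ∂P := by
  have hξm : Measurable fun ω j => ξ j ω := measurable_pi_lambda _ hξ
  have hWm : Measurable fun ω j => W j ω := measurable_pi_lambda _ hW
  set G : (ℤ → EuclideanSpace ℝ (Fin d)) × (ℤ → M) → ℂ :=
    fun q => ∏ j ∈ s, F (q.1 j, q.2 j) with hGdef
  have hG : Measurable G := Finset.measurable_fun_prod _ fun j _ => hF.comp
    (((measurable_pi_apply j).comp measurable_fst).prodMk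
      ((measurable_pi_apply j).comp measurable_snd))
  have hG1 : ∀ q, ‖G q‖ ≤ 1 := fun q => by
    rw [hGdef, norm_prod]
    exact Finset.prod_le_one (fun _ _ => norm_nonneg _) fun _ _ => hF1 _
  have : IsProbabilityMeasure (P.map fun ω j => ξ j ω) :=
    Measure.isProbabilityMeasure_map hξm.aemeasurable
  have : IsProbabilityMeasure (P.map fun ω j => W j ω) :=
    Measure.isProbabilityMeasure_map hWm.aemeasurable
  have h1 := integral_map (μ := P) (hξm.prodMk hWm).aemeasurable hG.aestronglyMeasurable
  have hinner : ∀ x : ℤ → EuclideanSpace ℝ (Fin d),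
      ∫ w, G (x, w) ∂(P.map fun ω j => W j ω) = ∏ j ∈ s, ∫ w, F (x j, w) ∂ν := fun x => by
    rw [integral_map hWm.aemeasurable (f := fun w => G (x, w))
      (hG.comp measurable_prodMk_left).aestronglyMeasurable]
    have hs : iIndepFun (fun j : s => W j) P :=
      hiind.precomp (g := ((↑) : s → ℤ)) Subtype.val_injective
    have h2 := hs.integral_fun_prod_comp (f := fun (j : s) w => F (x j, w)) (fun j => (hW j).aemeasurable)
      (fun j => (hF.comp measurable_prodMk_left).aestronglyMeasurable)
    simp only [hGdef]
    rw [← Finset.prod_coe_sort s fun j => ∫ w, F (x j, w) ∂ν]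
    simp_rw [← Finset.prod_coe_sort s]
    refine h2.trans (Finset.prod_congr rfl fun j _ => ?_)
    rw [← hlaw j, integral_map (f := fun w => F (x j, w)) (hW j).aemeasurable
      (hF.comp measurable_prodMk_left).aestronglyMeasurable]
  rw [← h1, hind.map_prod_eq_prod_map_map hξm.aemeasurable hWm.aemeasurable,
    integral_prod _ (Integrable.of_bound hG.aestronglyMeasurable 1 (Eventually.of_forall hG1))]
  simp_rw [hinner]
  refine integral_map hξm.aemeasurable (Measurable.aestronglyMeasurable ?_)
  exact Finset.measurable_fun_prod _ fun j _ =>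
    hF.stronglyMeasurable.integral_prod_right'.measurable.comp (measurable_pi_apply j)

/-- The generating functional of a homogeneous Poisson process with independent marks. -/
theorem IsHomogeneousPoisson.tendsto_integral_prod_marked (h : IsHomogeneousPoisson P lam ξ)
    (hW : ∀ j, Measurable (W j)) (hlaw : ∀ j, P.map (W j) = ν) (hiind : iIndepFun W P)
    (hind : IndepFun (fun ω j => ξ j ω) (fun ω j => W j ω) P)
    {F : EuclideanSpace ℝ (Fin d) × M → ℂ} (hF : Measurable F) (hF1 : ∀ p, ‖F p‖ ≤ 1)
    (hint : Integrable (fun p => F p - 1) (volume.prod ν)) :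
    Tendsto (fun s : Finset ℤ => ∫ ω, ∏ j ∈ s, F (ξ j ω, W j ω) ∂P) atTop
      (𝓝 (Complex.exp (lam * ∫ p, (F p - 1) ∂(volume.prod ν)))) := by
  simp_rw [integral_prod_marked h.measurable_point hW hlaw hiind hind hF hF1]
  have hsub : ∀ x, ∫ w, (F (x, w) - 1) ∂ν = ∫ w, F (x, w) ∂ν - 1 := fun x => by
    rw [integral_sub (f := fun w => F (x, w)) (Integrable.of_bound (hF.comp measurable_prodMk_left).aestronglyMeasurable 1
      (Eventually.of_forall fun w => hF1 _)) (integrable_const _)]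
    simp
  have hint' := hint.integral_prod_left
  rw [integral_prod _ hint]
  simp only [hsub] at hint' ⊢
  refine h.tendsto_integral_prod hF.stronglyMeasurable.integral_prod_right'.measurable
    (fun x => ?_) hint'
  refine (norm_integral_le_of_norm_le_const (Eventually.of_forall fun w => hF1 (x, w))).trans ?_
  simp

end Marked

/-! ### Overlap volumes, the matrix `Σ_H` and the Taylor expansion of the exponent. -/

section Overlap

variable {d n : ℕ} {Ω' : Type*} [MeasurableSpace Ω'] {P' : Measure Ω'} [IsProbabilityMeasure P']
  {Y : ℝ≥0 → Ω' → EuclideanSpace ℝ (Fin d)} {B : Set (EuclideanSpace ℝ (Fin d))}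
  {ν : Measure (Fin n → EuclideanSpace ℝ (Fin d))} [IsProbabilityMeasure ν]

/-- The particles, given by a starting point and the displacements at `n` times, that are in `B`
at the time of index `k`. -/
def hitSet (B : Set (EuclideanSpace ℝ (Fin d))) (k : Fin n) :
    Set (EuclideanSpace ℝ (Fin d) × (Fin n → EuclideanSpace ℝ (Fin d))) :=
  {p | p.1 + p.2 k ∈ B}

theorem measurableSet_hitSet (hB : MeasurableSet B) (k : Fin n) : MeasurableSet (hitSet B k) :=
  measurableSet_preimage
    (measurable_fst.add ((measurable_pi_apply k).comp measurable_snd)) hB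

/-- For fixed displacements the section is a translate of `B`. This is why the mean count is `ρ` at
every time. -/
theorem measure_hitSet (hB : MeasurableSet B) (k : Fin n) :
    (volume.prod ν) (hitSet B k) = volume B := by
  rw [Measure.prod_apply_symm (measurableSet_hitSet hB k)]
  have : ∀ w : Fin n → EuclideanSpace ℝ (Fin d),
      volume ((fun x => (x, w)) ⁻¹' hitSet B k) = volume B := fun w =>
    measure_preimage_add_right volume (w k) B
  simp [this]

/-- The law of the displacements at the times `t k`. -/
noncomputable def displacementLaw (P' : Measure Ω') (Y : ℝ≥0 → Ω' → EuclideanSpace ℝ (Fin d))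
    (t : Fin n → ℝ≥0) : Measure (Fin n → EuclideanSpace ℝ (Fin d)) :=
  P'.map fun ω k => Y (t k) ω

theorem isProbabilityMeasure_displacementLaw (hY : ∀ s, Measurable (Y s)) (t : Fin n → ℝ≥0) :
    IsProbabilityMeasure (displacementLaw P' Y t) :=
  Measure.isProbabilityMeasure_map (measurable_pi_lambda _ fun k => hY (t k)).aemeasurable

/-- The particles that are in `B` at exactly the times with index in `π`. -/
def patternSet (B : Set (EuclideanSpace ℝ (Fin d))) (π : Finset (Fin n)) :
    Set (EuclideanSpace ℝ (Fin d) × (Fin n → EuclideanSpace ℝ (Fin d))) :=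
  {p | ∀ k, k ∈ π ↔ p ∈ hitSet B k}

theorem measurableSet_patternSet (hB : MeasurableSet B) (π : Finset (Fin n)) :
    MeasurableSet (patternSet B π) := by
  have : patternSet B π = ⋂ k, {p | k ∈ π ↔ p ∈ hitSet B k} := by
    ext p
    simp [patternSet]
  rw [this]
  refine MeasurableSet.iInter fun k => ?_
  by_cases hk : k ∈ π
  · simpa [hk] using measurableSet_hitSet hB k
  · simp only [hk, false_iff]
    exact (measurableSet_hitSet hB k).compl

theorem Qbar_eq_measureReal (hY : ∀ s, Measurable (Y s)) (hB : MeasurableSet B)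
    (t : Fin n → ℝ≥0) (π : Finset (Fin n)) :
    Qbar P' Y B t π = (volume.prod (displacementLaw P' Y t)).real (patternSet B π) := by
  have hYm : Measurable fun ω k => Y (t k) ω := measurable_pi_lambda _ fun k => hY (t k)
  have := isProbabilityMeasure_displacementLaw (P' := P') hY t
  have hQ : ∀ x, Q P' Y B t π x =
      (displacementLaw P' Y t (Prod.mk x ⁻¹' patternSet B π)).toReal := fun x => by
    rw [displacementLaw, Measure.map_apply hYm
      (measurable_prodMk_left (measurableSet_patternSet hB π)), Q, Measure.real]
    congr 2
    ext ω
    simp only [Set.mem_preimage, patternSet, hitSet, Set.mem_ofPred_eq]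
    exact ⟨fun h k => ⟨h.1 k, fun hk => by_contra fun hn => h.2 k hn hk⟩,
      fun h => ⟨fun k hk => (h k).1 hk, fun k hk hn => hk ((h k).2 hn)⟩⟩
  simp_rw [Qbar, hQ]
  rw [integral_toReal (measurable_measure_prodMk_left
    (measurableSet_patternSet hB π)).aemeasurable (Eventually.of_forall fun x => measure_lt_top _ _),
    ← Measure.prod_apply (measurableSet_patternSet hB π), Measure.real]

/-- The patterns `π ⊇ {i, j}` partition the particles that are in `B` at both times. -/
theorem sigmaH_apply_eq (hY : ∀ s, Measurable (Y s)) (hB : MeasurableSet B)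
    (hBfin : volume B < ∞) (t : Fin n → ℝ≥0) (i j : Fin n) :
    sigmaH P' Y B t i j = 1 / volume.real B *
      (volume.prod (displacementLaw P' Y t)).real (hitSet B i ∩ hitSet B j) := by
  classical
  have := isProbabilityMeasure_displacementLaw (P' := P') hY t
  simp only [sigmaH, Matrix.of_apply, U]
  congr 1
  simp_rw [Qbar_eq_measureReal hY hB]
  have hU : hitSet B i ∩ hitSet B j =
      ⋃ π ∈ Finset.univ.filter (fun π : Finset (Fin n) => {i, j} ⊆ π), patternSet B π := by
    ext p
    simp only [Set.mem_iUnion, Finset.mem_filter, Finset.mem_univ, true_and, exists_prop]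
    constructor
    · rintro ⟨hi, hj⟩
      refine ⟨Finset.univ.filter fun k => p ∈ hitSet B k, ?_, fun k => by simp⟩
      simp [Finset.insert_subset_iff, hi, hj]
    · rintro ⟨π, hπ, hp⟩
      exact ⟨(hp i).1 (hπ (by simp)), (hp j).1 (hπ (by simp))⟩
  rw [hU]
  refine (measureReal_biUnion_finset ?_ ?_ ?_).symm
  · intro π _ π' _ hne
    refine Set.disjoint_left.2 fun p hp hp' => hne ?_
    ext k
    rw [hp k, hp' k]
  · exact fun π _ => measurableSet_patternSet hB π
  · intro π hπ
    refine ((measure_mono fun p hp => ?_).trans_lt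
      ((measure_hitSet (ν := displacementLaw P' Y t) hB i).trans_lt hBfin)).ne
    exact (hp i).1 ((Finset.mem_filter.1 hπ).2 (by simp))

/-- The weighted number of times `∑ k, a k 1{x + w k ∈ B}`. -/
noncomputable def weightedHits (B : Set (EuclideanSpace ℝ (Fin d))) (a : Fin n → ℝ)
    (p : EuclideanSpace ℝ (Fin d) × (Fin n → EuclideanSpace ℝ (Fin d))) : ℝ :=
  ∑ k, a k * (hitSet B k).indicator 1 p

theorem integrable_indicator_hitSet (hB : MeasurableSet B) (hBfin : volume B < ∞) (k : Fin n) :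
    Integrable (fun p => ((hitSet B k).indicator 1 p : ℝ)) (volume.prod ν) :=
  (integrable_indicator_iff (measurableSet_hitSet hB k)).2
    (integrableOn_const ((measure_hitSet hB k).trans_lt hBfin).ne)

theorem measurable_weightedHits (hB : MeasurableSet B) (a : Fin n → ℝ) :
    Measurable (weightedHits B a) :=
  Finset.measurable_fun_sum _ fun k _ =>
    (measurable_one.indicator (measurableSet_hitSet hB k)).const_mul _

theorem integrable_weightedHits (hB : MeasurableSet B) (hBfin : volume B < ∞) (a : Fin n → ℝ) :
    Integrable (weightedHits B a) (volume.prod ν) :=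
  integrable_finsetSum _ fun k _ => (integrable_indicator_hitSet hB hBfin k).const_mul _

theorem integral_weightedHits (hB : MeasurableSet B) (hBfin : volume B < ∞) (a : Fin n → ℝ) :
    ∫ p, weightedHits B a p ∂(volume.prod ν) = volume.real B * ∑ k, a k := by
  simp_rw [weightedHits]
  rw [integral_finsetSum _ fun k _ => (integrable_indicator_hitSet hB hBfin k).const_mul _,
    Finset.mul_sum]
  refine Finset.sum_congr rfl fun k _ => ?_
  rw [integral_const_mul, integral_indicator_one (measurableSet_hitSet hB k), Measure.real,
    measure_hitSet hB k, mul_comm, Measure.real]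

theorem abs_weightedHits_le (a : Fin n → ℝ) (p) :
    |weightedHits B a p| ≤ weightedHits B (fun k => |a k|) p := by
  refine (Finset.abs_sum_le_sum_abs _ _).trans (Finset.sum_le_sum fun k _ => ?_)
  rw [abs_mul, abs_of_nonneg (a := (hitSet B k).indicator 1 p)
    (Set.indicator_nonneg (fun _ _ => zero_le_one) _)]

theorem abs_weightedHits_le_sum (a : Fin n → ℝ) (p) :
    |weightedHits B a p| ≤ ∑ k, |a k| := by
  refine (abs_weightedHits_le a p).trans (Finset.sum_le_sum fun k _ => ?_)
  exact mul_le_of_le_one_right (abs_nonneg _)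
    (Set.indicator_le_self' (fun _ _ => zero_le_one) _ |>.trans le_rfl)

theorem integrable_sq_weightedHits (hB : MeasurableSet B) (hBfin : volume B < ∞) (a : Fin n → ℝ) :
    Integrable (fun p => weightedHits B a p ^ 2) (volume.prod ν) := by
  simp_rw [sq]
  exact (integrable_weightedHits hB hBfin a).bdd_mul
    (measurable_weightedHits hB a).aestronglyMeasurable
    (Eventually.of_forall fun p => abs_weightedHits_le_sum a p)

theorem integral_sq_weightedHits (hY : ∀ s, Measurable (Y s)) (hB : MeasurableSet B)
    (hBfin : volume B < ∞) (hB0 : 0 < volume.real B) (t : Fin n → ℝ≥0) (a : Fin n → ℝ) :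
    ∫ p, weightedHits B a p ^ 2 ∂(volume.prod (displacementLaw P' Y t)) =
      volume.real B * (a ⬝ᵥ (sigmaH P' Y B t).mulVec a) := by
  have := isProbabilityMeasure_displacementLaw (P' := P') hY t
  have hexp : ∀ p, weightedHits B a p ^ 2 = ∑ i, ∑ j, a i * a j *
      (hitSet B i ∩ hitSet B j).indicator 1 p := fun p => by
    rw [sq, weightedHits, Finset.sum_mul_sum]
    refine Finset.sum_congr rfl fun i _ => Finset.sum_congr rfl fun j _ => ?_
    rw [Set.inter_indicator_one, Pi.mul_apply]
    ring
  have hint : ∀ i j, Integrable (fun p => a i * a j *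
      ((hitSet B i ∩ hitSet B j).indicator 1 p : ℝ))
      (volume.prod (displacementLaw P' Y t)) := fun i j =>
    ((integrable_indicator_iff ((measurableSet_hitSet hB i).inter (measurableSet_hitSet hB j))).2
      (integrableOn_const ((measure_mono Set.inter_subset_left).trans_lt
        ((measure_hitSet hB i).trans_lt hBfin)).ne)).const_mul _
  simp_rw [hexp]
  rw [integral_finsetSum _ fun i _ => integrable_finsetSum _ fun j _ => hint i j]
  simp only [dotProduct, Matrix.mulVec, Finset.mul_sum]
  refine Finset.sum_congr rfl fun i _ => ?_
  rw [integral_finsetSum _ fun j _ => hint i j]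
  refine Finset.sum_congr rfl fun j _ => ?_
  rw [integral_const_mul, integral_indicator_one
    ((measurableSet_hitSet hB i).inter (measurableSet_hitSet hB j)),
    sigmaH_apply_eq hY hB hBfin]
  field_simp

/-- Up to the factor `vol B`, the quadratic form is the integral of the square of `weightedHits`. -/
theorem posSemidef_sigmaH (hY : ∀ s, Measurable (Y s)) (hB : MeasurableSet B)
    (hBfin : volume B < ∞) (hB0 : 0 < volume.real B) (t : Fin n → ℝ≥0) :
    (sigmaH P' Y B t).PosSemidef := by
  refine Matrix.posSemidef_iff_dotProduct_mulVec.2 ⟨?_, fun a => ?_⟩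
  · ext i j
    simp [sigmaH, Finset.pair_comm]
  · have h := integral_sq_weightedHits (P' := P') hY hB hBfin hB0 t a
    rw [star_trivial]
    refine nonneg_of_mul_nonneg_right (h ▸ integral_nonneg fun p => sq_nonneg _) hB0

/-- Third-order Taylor remainder. Two of the three factors `|x|` are bounded by `A`; the last is
kept because the bound must be integrated over a space of infinite measure. -/
theorem norm_exp_mul_I_sub_le (x : ℝ) {A : ℝ} (hx : |x| ≤ A) :
    ‖Complex.exp (x * Complex.I) - 1 - (x * Complex.I - (x ^ 2 : ℝ) / 2)‖ ≤
      A ^ 2 * Real.exp A * |x| := by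
  have h := Complex.norm_exp_sub_sum_le_norm_mul_exp (x * Complex.I) 3
  have hn : ‖(x * Complex.I : ℂ)‖ = |x| := by simp
  simp only [Finset.sum_range_succ, Finset.sum_range_zero, hn] at h
  have he : Complex.exp (x * Complex.I) - 1 - (x * Complex.I - (x ^ 2 : ℝ) / 2) =
      Complex.exp (x * Complex.I) - (0 + (x * Complex.I) ^ 0 / (Nat.factorial 0 : ℂ) +
        (x * Complex.I) ^ 1 / (Nat.factorial 1 : ℂ) +
        (x * Complex.I) ^ 2 / (Nat.factorial 2 : ℂ)) := by
    simp only [mul_pow, Complex.I_sq, Nat.factorial]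
    push_cast
    ring
  rw [he]
  refine h.trans ?_
  have : 0 ≤ A := (abs_nonneg x).trans hx
  calc |x| ^ 3 * Real.exp |x| = |x| ^ 2 * Real.exp |x| * |x| := by ring
    _ ≤ A ^ 2 * Real.exp A * |x| := by gcongr

theorem integrable_exp_weightedHits_sub_one (hB : MeasurableSet B) (hBfin : volume B < ∞)
    (a : Fin n → ℝ) :
    Integrable (fun p => Complex.exp (weightedHits B a p * Complex.I) - 1) (volume.prod ν) := by
  refine (integrable_weightedHits hB hBfin a).mono
    ((Complex.measurable_exp.comp ((Complex.measurable_ofReal.comp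
      (measurable_weightedHits hB a)).mul_const _)).sub_const 1).aestronglyMeasurable
    (Eventually.of_forall fun p => ?_)
  rw [mul_comm]
  exact Real.norm_exp_I_mul_ofReal_sub_one_le

/-- The kept factor integrates to a multiple of `vol B`, so after multiplication by `lam` the region
enters the error only through `ρ`. -/
theorem norm_integral_exp_weightedHits_sub_le (hY : ∀ s, Measurable (Y s)) (hB : MeasurableSet B)
    (hBfin : volume B < ∞) (hB0 : 0 < volume.real B) (t : Fin n → ℝ≥0) (a : Fin n → ℝ) :
    ‖∫ p, (Complex.exp (weightedHits B a p * Complex.I) - 1)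
        ∂(volume.prod (displacementLaw P' Y t)) -
      volume.real B * ((∑ k, a k : ℝ) * Complex.I -
        (a ⬝ᵥ (sigmaH P' Y B t).mulVec a : ℝ) / 2)‖ ≤
      volume.real B * ((∑ k, |a k|) ^ 3 * Real.exp (∑ k, |a k|)) := by
  have := isProbabilityMeasure_displacementLaw (P' := P') hY t
  set κ := (volume : Measure (EuclideanSpace ℝ (Fin d))).prod (displacementLaw P' Y t) with hκ
  have hi1 : Integrable (fun p => (weightedHits B a p : ℂ) * Complex.I) κ :=
    (integrable_weightedHits hB hBfin a).ofReal.mul_const _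
  have hi2 : Integrable (fun p => ((weightedHits B a p ^ 2 : ℝ) : ℂ) / 2) κ :=
    (integrable_sq_weightedHits hB hBfin a).ofReal.div_const _
  have hmain : (volume.real B : ℂ) * ((∑ k, a k : ℝ) * Complex.I -
        (a ⬝ᵥ (sigmaH P' Y B t).mulVec a : ℝ) / 2) =
      ∫ p, ((weightedHits B a p : ℂ) * Complex.I - ((weightedHits B a p ^ 2 : ℝ) : ℂ) / 2) ∂κ := by
    rw [integral_sub hi1 hi2, integral_mul_const, integral_div, integral_complex_ofReal,
      integral_complex_ofReal, integral_weightedHits hB hBfin,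
      integral_sq_weightedHits hY hB hBfin hB0]
    push_cast
    ring
  rw [hmain, ← integral_sub (g := fun p => (weightedHits B a p : ℂ) * Complex.I -
    ((weightedHits B a p ^ 2 : ℝ) : ℂ) / 2) (integrable_exp_weightedHits_sub_one hB hBfin a)
    (hi1.sub hi2)]
  have hiabs : Integrable (fun p => (∑ k, |a k|) ^ 2 * Real.exp (∑ k, |a k|) *
      weightedHits B (fun k => |a k|) p) κ :=
    (integrable_weightedHits hB hBfin _).const_mul _
  refine (norm_integral_le_of_norm_le hiabs (Eventually.of_forall fun p => ?_)).trans ?_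
  · refine (norm_exp_mul_I_sub_le _ (abs_weightedHits_le_sum a p)).trans ?_
    gcongr
    exact abs_weightedHits_le a p
  · rw [integral_const_mul, integral_weightedHits hB hBfin]
    exact le_of_eq (by ring)

end Overlap

end Smoluchowski

namespace Smoluchowski

/-! ### Characteristic function of the normalized counts. -/

section ParticleSystem

variable {d n : ℕ} {Ω Ω' : Type*} {ξ : ℤ → Ω → EuclideanSpace ℝ (Fin d)}
  {Z : ℤ → ℝ≥0 → Ω → EuclideanSpace ℝ (Fin d)} {B : Set (EuclideanSpace ℝ (Fin d))}

theorem tendsto_sum_weightedHits (a : Fin n → ℝ) (t : Fin n → ℝ≥0) (ω : Ω)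
    (hω : ∀ k, count B ξ Z (t k) ω < ∞) :
    Tendsto (fun s : Finset ℤ => ∑ j ∈ s, weightedHits B a (ξ j ω, fun k => Z j (t k) ω)) atTop
      (𝓝 (∑ k, a k * (count B ξ Z (t k) ω).toReal)) := by
  simp_rw [weightedHits]
  refine Tendsto.congr (fun s => Finset.sum_comm) (tendsto_finsetSum _ fun k _ => ?_)
  simp_rw [← Finset.mul_sum]
  refine Tendsto.const_mul _ ?_
  have hsum : Tendsto (fun s : Finset ℤ => ∑ j ∈ s,
      B.indicator (1 : EuclideanSpace ℝ (Fin d) → ℝ≥0∞) (ξ j ω + Z j (t k) ω)) atTop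
      (𝓝 (count B ξ Z (t k) ω)) := ENNReal.summable.hasSum
  refine ((ENNReal.tendsto_toReal (hω k).ne).comp hsum).congr fun s => ?_
  simp only [Function.comp_apply]
  have hne : ∀ j, B.indicator (1 : EuclideanSpace ℝ (Fin d) → ℝ≥0∞) (ξ j ω + Z j (t k) ω) ≠ ∞ :=
    fun j => by
      by_cases hj : ξ j ω + Z j (t k) ω ∈ B <;> simp [hj]
  rw [ENNReal.toReal_sum fun j _ => hne j]
  refine Finset.sum_congr rfl fun j _ => ?_
  by_cases hj : ξ j ω + Z j (t k) ω ∈ B <;> simp [hitSet, hj]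

variable [MeasurableSpace Ω] [MeasurableSpace Ω'] {P : Measure Ω} {P' : Measure Ω'}
  {lam : ℝ≥0} {Y : ℝ≥0 → Ω' → EuclideanSpace ℝ (Fin d)}

theorem measurable_eval_times (t : Fin n → ℝ≥0) :
    Measurable fun (z : ℝ≥0 → EuclideanSpace ℝ (Fin d)) k => z (t k) :=
  measurable_pi_lambda _ fun k => measurable_pi_apply (t k)

theorem IsParticleSystem.map_displacement (h : IsParticleSystem P lam ξ Z P' Y) (t : Fin n → ℝ≥0)
    (j : ℤ) : P.map (fun ω k => Z j (t k) ω) = displacementLaw P' Y t :=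
  ((h.identDistrib j).comp (measurable_eval_times t)).map_eq

theorem IsParticleSystem.iIndepFun_displacement (h : IsParticleSystem P lam ξ Z P' Y)
    (t : Fin n → ℝ≥0) : iIndepFun (fun j ω k => Z j (t k) ω) P :=
  h.iIndep.comp (fun _ z k => z (t k)) fun _ => measurable_eval_times t

theorem IsParticleSystem.indepFun_displacement (h : IsParticleSystem P lam ξ Z P' Y)
    (t : Fin n → ℝ≥0) : IndepFun (fun ω j => ξ j ω) (fun ω j k => Z j (t k) ω) P :=
  h.indep.comp (φ := id) (ψ := fun (z : ℤ → ℝ≥0 → EuclideanSpace ℝ (Fin d)) j k => z j (t k))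
    measurable_id (measurable_pi_lambda _ fun j =>
      (measurable_eval_times t).comp (measurable_pi_apply j))

theorem IsParticleSystem.measurable_displacement_times (h : IsParticleSystem P lam ξ Z P' Y)
    (t : Fin n → ℝ≥0) (j : ℤ) : Measurable fun ω k => Z j (t k) ω :=
  measurable_pi_lambda _ fun k => h.measurable_displacement j (t k)

theorem IsParticleSystem.measurable_count (h : IsParticleSystem P lam ξ Z P' Y)
    (hB : MeasurableSet B) (s : ℝ≥0) : Measurable (count B ξ Z s) :=
  Measurable.tsum fun j => (measurable_one.indicator hB).comp
    ((h.poisson.measurable_point j).add (h.measurable_displacement j s))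

theorem IsParticleSystem.measurable_normalizedCount (h : IsParticleSystem P lam ξ Z P' Y)
    (hB : MeasurableSet B) (t : Fin n → ℝ≥0) : Measurable (normalizedCount lam B ξ Z t) :=
  (WithLp.measurable_toLp 2 _).comp (measurable_pi_lambda _ fun k =>
    ((h.measurable_count hB (t k)).ennreal_toReal.sub_const _).div_const _)

variable [IsProbabilityMeasure P] [IsProbabilityMeasure P']

theorem IsParticleSystem.lintegral_count (h : IsParticleSystem P lam ξ Z P' Y)
    (hY : ∀ s, Measurable (Y s)) (hB : MeasurableSet B) (s : ℝ≥0) :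
    ∫⁻ ω, count B ξ Z s ω ∂P = lam * volume B := by
  -- A single time is treated as a vector of length one, so that the marked Campbell formula
  -- applies.
  set t : Fin 1 → ℝ≥0 := fun _ => s
  have := isProbabilityMeasure_displacementLaw (P' := P') hY t
  have hcamp := h.poisson.tsum_lintegral_marked (h.measurable_displacement_times t)
    (h.map_displacement t) (h.indepFun_displacement t)
    (f := (hitSet B 0).indicator 1) (measurable_one.indicator (measurableSet_hitSet hB 0))
  rw [lintegral_indicator_one (measurableSet_hitSet hB 0), measure_hitSet hB] at hcamp
  rw [← hcamp]
  exact lintegral_tsum fun j => ((measurable_one.indicator hB).comp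
    ((h.poisson.measurable_point j).add (h.measurable_displacement j s))).aemeasurable

theorem IsParticleSystem.ae_count_lt_top (h : IsParticleSystem P lam ξ Z P' Y)
    (hY : ∀ s, Measurable (Y s)) (hB : MeasurableSet B) (hBfin : volume B < ∞) (s : ℝ≥0) :
    ∀ᵐ ω ∂P, count B ξ Z s ω < ∞ := by
  refine ae_lt_top (h.measurable_count hB s) ?_
  rw [h.lintegral_count hY hB]
  exact ENNReal.mul_ne_top ENNReal.coe_ne_top hBfin.ne

/-- The joint characteristic function of the counts. -/
theorem IsParticleSystem.integral_exp_count (h : IsParticleSystem P lam ξ Z P' Y)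
    (hY : ∀ s, Measurable (Y s)) (hB : MeasurableSet B) (hBfin : volume B < ∞)
    (t : Fin n → ℝ≥0) (a : Fin n → ℝ) :
    ∫ ω, Complex.exp ((∑ k, a k * (count B ξ Z (t k) ω).toReal : ℝ) * Complex.I) ∂P =
      Complex.exp (lam * ∫ p, (Complex.exp (weightedHits B a p * Complex.I) - 1)
        ∂(volume.prod (displacementLaw P' Y t))) := by
  have := isProbabilityMeasure_displacementLaw (P' := P') hY t
  have hFm : Measurable fun p => Complex.exp (weightedHits B a p * Complex.I) :=
    Complex.measurable_exp.comp ((Complex.measurable_ofReal.comp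
      (measurable_weightedHits hB a)).mul_const _)
  have h1 := h.poisson.tendsto_integral_prod_marked (h.measurable_displacement_times t)
    (h.map_displacement t) (h.iIndepFun_displacement t) (h.indepFun_displacement t) hFm
    (fun p => (Complex.norm_exp_ofReal_mul_I _).le)
    (integrable_exp_weightedHits_sub_one hB hBfin a)
  -- Both sides are limits of the same expectations over finite sets of particles; the left one by
  -- dominated convergence, the integrands having norm `1`.
  refine tendsto_nhds_unique ?_ h1
  simp_rw [← Complex.exp_sum, ← Finset.sum_mul, ← Complex.ofReal_sum]
  refine tendsto_integral_filter_of_dominated_convergence (fun _ => 1) ?_ ?_ (integrable_const _) ?_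
  · refine Eventually.of_forall fun s => (Complex.measurable_exp.comp
      ((Complex.measurable_ofReal.comp (Finset.measurable_fun_sum _ fun j _ => ?_)).mul_const
        _)).aestronglyMeasurable
    exact (measurable_weightedHits hB a).comp
      ((h.poisson.measurable_point j).prodMk (h.measurable_displacement_times t j))
  · exact Eventually.of_forall fun s => Eventually.of_forall fun ω =>
      (Complex.norm_exp_ofReal_mul_I _).le
  · filter_upwards [ae_all_iff.2 fun k => h.ae_count_lt_top hY hB hBfin (t k)] with ω hω
    exact (Complex.continuous_exp.tendsto _).comp (((Complex.continuous_ofReal.tendsto _).comp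
      (tendsto_sum_weightedHits a t ω hω)).mul_const _)

theorem IsParticleSystem.charFun_normalizedCount (h : IsParticleSystem P lam ξ Z P' Y)
    (hY : ∀ s, Measurable (Y s)) (hB : MeasurableSet B) (hBfin : volume B < ∞)
    (hB0 : 0 < volume.real B) (hlam : 0 < lam) (t : Fin n → ℝ≥0) (θ : EuclideanSpace ℝ (Fin n)) :
    ∃ R : ℂ, ‖R‖ ≤ (∑ k, |θ k|) ^ 3 / √(rho lam B) * Real.exp ((∑ k, |θ k|) / √(rho lam B)) ∧
      charFun (P.map (normalizedCount lam B ξ Z t)) θ =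
        Complex.exp (-(θ ⬝ᵥ (sigmaH P' Y B t).mulVec θ : ℝ) / 2 + R) := by
  set r := √(rho lam B) with hr
  have hrho : 0 < rho lam B := mul_pos (by exact_mod_cast hlam) hB0
  have hr0 : 0 < r := Real.sqrt_pos.2 hrho
  have hrr' : rho lam B = r ^ 2 := (Real.sq_sqrt hrho.le).symm
  have hrr : (lam : ℝ) * volume.real B = r ^ 2 := hrr'
  have hrrC : (lam : ℂ) * volume.real B = (r : ℂ) ^ 2 := by exact_mod_cast hrr
  have hrC : (r : ℂ) ≠ 0 := by exact_mod_cast hr0.ne'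
  set a : Fin n → ℝ := fun k => θ k / r with ha
  set J := ∫ p, (Complex.exp (weightedHits B a p * Complex.I) - 1)
        ∂(volume.prod (displacementLaw P' Y t)) with hJ
  set D := (volume.real B : ℂ) * ((∑ k, a k : ℝ) * Complex.I -
        (a ⬝ᵥ (sigmaH P' Y B t).mulVec a : ℝ) / 2) with hD
  have hsum : ∑ k, a k = (∑ k, θ k) / r := by rw [ha, Finset.sum_div]
  have habs : ∑ k, |a k| = (∑ k, |θ k|) / r := by
    simp only [ha, abs_div, abs_of_pos hr0, Finset.sum_div]
  have hquad : a ⬝ᵥ (sigmaH P' Y B t).mulVec a = (θ ⬝ᵥ (sigmaH P' Y B t).mulVec θ) / r ^ 2 := by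
    have : a = r⁻¹ • (θ : Fin n → ℝ) := by
      ext k
      simp [ha, div_eq_inv_mul]
    rw [this, Matrix.mulVec_smul, smul_dotProduct, dotProduct_smul, smul_eq_mul, smul_eq_mul]
    field_simp
  -- Since `lam * vol B = r ^ 2`, scaling by `1 / r` leaves a linear term of size `r`, to be
  -- cancelled by the centering in `hinner`, and a quadratic term free of `r`.
  have hlamD : lam * D = r * (∑ k, θ k : ℝ) * Complex.I -
      (θ ⬝ᵥ (sigmaH P' Y B t).mulVec θ : ℝ) / 2 := by
    rw [hD, ← mul_assoc, hrrC, hsum, hquad]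
    push_cast
    field_simp
  -- `J` is the exact exponent per unit rate and `D` its second-order expansion.
  refine ⟨lam * (J - D), ?_, ?_⟩
  · have hb := norm_integral_exp_weightedHits_sub_le (P' := P') hY hB hBfin hB0 t a
    rw [← hJ, ← hD, habs] at hb
    have hl : ‖(lam : ℂ)‖ = lam := by simp
    rw [norm_mul, hl]
    calc (lam : ℝ) * ‖J - D‖ ≤ lam * (volume.real B * (((∑ k, |θ k|) / r) ^ 3 *
          Real.exp ((∑ k, |θ k|) / r))) := by gcongr
      _ = r ^ 2 * (((∑ k, |θ k|) / r) ^ 3 * Real.exp ((∑ k, |θ k|) / r)) := by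
          rw [← mul_assoc, hrr]
      _ = _ := by field_simp
  · rw [charFun_apply, integral_map (h.measurable_normalizedCount hB t).aemeasurable (by fun_prop)]
    have hinner : ∀ ω, inner ℝ (normalizedCount lam B ξ Z t ω) θ =
        ∑ k, a k * (count B ξ Z (t k) ω).toReal + -(r * ∑ k, θ k) := fun ω => by
      rw [PiLp.inner_apply, Finset.mul_sum, ← Finset.sum_neg_distrib, ← Finset.sum_add_distrib]
      refine Finset.sum_congr rfl fun k _ => ?_
      simp only [normalizedCount, ha, hrr', Real.sqrt_sq hr0.le, RCLike.inner_apply, conj_trivial]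
      field_simp
      ring
    have hsplit : ∀ x y : ℝ, Complex.exp ((x + y : ℝ) * Complex.I) =
        Complex.exp (x * Complex.I) * Complex.exp (y * Complex.I) := fun x y => by
      rw [Complex.ofReal_add, add_mul, Complex.exp_add]
    simp_rw [hinner, hsplit]
    rw [integral_mul_const, h.integral_exp_count hY hB hBfin, ← hJ, ← Complex.exp_add]
    have hJD : lam * J = lam * D + lam * (J - D) := by ring
    rw [hJD, hlamD]
    congr 1
    push_cast
    ring

end ParticleSystem

/-- A Lévy convergence theorem along arbitrary filters, for laws whose characteristic functions are
controlled by countably generated data. -/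
theorem tendsto_probabilityMeasure_of_charFun {ι E : Type*} [NormedAddCommGroup E]
    [InnerProductSpace ℝ E] [FiniteDimensional ℝ E] [MeasurableSpace E] [BorelSpace E]
    {l m : Filter ι} [m.IsCountablyGenerated] (hlm : l ≤ m) {μ : ι → ProbabilityMeasure E}
    {μ₀ : ProbabilityMeasure E}
    (h : ∀ θ, Tendsto (fun i => charFun (μ i : Measure E) θ) m (𝓝 (charFun μ₀ θ))) :
    Tendsto μ l (𝓝 μ₀) :=
  Tendsto.mono_left (tendsto_of_seq_tendsto fun _ hu =>
    ProbabilityMeasure.tendsto_of_tendsto_charFun fun θ => (h θ).comp hu) hlm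

theorem posSemidef_of_tendsto {ι : Type*} {n : ℕ} {l : Filter ι} [l.NeBot]
    {A : ι → Matrix (Fin n) (Fin n) ℝ} {S : Matrix (Fin n) (Fin n) ℝ}
    (hA : ∀ i, (A i).PosSemidef) (h : Tendsto A l (𝓝 S)) : S.PosSemidef := by
  refine Matrix.posSemidef_iff_dotProduct_mulVec.2 ⟨?_, fun x => ?_⟩
  · refine tendsto_nhds_unique ?_ h
    exact ((continuous_id.matrix_conjTranspose.tendsto S).comp h).congr fun i => (hA i).1
  · have hc : Continuous fun A : Matrix (Fin n) (Fin n) ℝ => star x ⬝ᵥ A.mulVec x := by fun_prop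
    exact ge_of_tendsto' ((hc.tendsto S).comp h) fun i =>
      (Matrix.posSemidef_iff_dotProduct_mulVec.1 (hA i)).2 x

end Smoluchowski


/-! ### The central limit theorem along a filter. -/

theorem mainTheorem7 {d n : ℕ} (t : Fin n → ℝ≥0)
    {Ω' : Type*} [MeasurableSpace Ω'] (P' : Measure Ω') [IsProbabilityMeasure P']
    (Y : ℝ≥0 → Ω' → EuclideanSpace ℝ (Fin d)) (hY : Smoluchowski.IsDisplacement P' Y)
    {ι : Type*} (l : Filter ι) [l.NeBot]
    {Ω : ι → Type*} [∀ i, MeasurableSpace (Ω i)] (P : ∀ i, Measure (Ω i))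
    [∀ i, IsProbabilityMeasure (P i)]
    (lam : ι → ℝ≥0) (hlam : ∀ i, 0 < lam i)
    (B : ι → Set (EuclideanSpace ℝ (Fin d)))
    (hB : ∀ i, IsCompact (B i)) (hBint : ∀ i, (interior (B i)).Nonempty)
    (ξ : ∀ i, ℤ → Ω i → EuclideanSpace ℝ (Fin d))
    (Z : ∀ i, ℤ → ℝ≥0 → Ω i → EuclideanSpace ℝ (Fin d))
    (hsys : ∀ i, Smoluchowski.IsParticleSystem (P i) (lam i) (ξ i) (Z i) P' Y)
    (hrho : Tendsto (fun i => Smoluchowski.rho (lam i) (B i)) l atTop) :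
    -- the counts are almost surely finite
    (∀ i s, ∀ᵐ ω ∂(P i), Smoluchowski.count (B i) (ξ i) (Z i) s ω < ∞) ∧
    -- fixed observation region
    (∀ B₀ : Set (EuclideanSpace ℝ (Fin d)), (∀ i, B i = B₀) →
      (Smoluchowski.sigmaH P' Y B₀ t).PosSemidef ∧
      TendstoInDistribution
        (fun i => Smoluchowski.normalizedCount (lam i) (B i) (ξ i) (Z i) t) l
        id P (multivariateGaussian 0 (Smoluchowski.sigmaH P' Y B₀ t))) ∧
    -- observation region varying with the index
    (∀ S : Matrix (Fin n) (Fin n) ℝ,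
      Tendsto (fun i => Smoluchowski.sigmaH P' Y (B i) t) l (𝓝 S) →
      S.PosSemidef ∧
      TendstoInDistribution
        (fun i => Smoluchowski.normalizedCount (lam i) (B i) (ξ i) (Z i) t) l
        id P (multivariateGaussian 0 S)) := by

  have hYm := hY.measurable
  have hBm : ∀ i, MeasurableSet (B i) := fun i => (hB i).measurableSet
  have hBfin : ∀ i, volume (B i) < ∞ := fun i => (hB i).measure_lt_top
  have hB0 : ∀ i, 0 < volume.real (B i) := fun i =>
    ENNReal.toReal_pos (Measure.measure_pos_of_nonempty_interior volume (hBint i)).ne' (hBfin i).ne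
  have hvar : ∀ S : Matrix (Fin n) (Fin n) ℝ,
      Tendsto (fun i => Smoluchowski.sigmaH P' Y (B i) t) l (𝓝 S) →
      S.PosSemidef ∧
      TendstoInDistribution
        (fun i => Smoluchowski.normalizedCount (lam i) (B i) (ξ i) (Z i) t) l
        id P (multivariateGaussian 0 S) := fun S hS => by
    have hSpsd : S.PosSemidef := Smoluchowski.posSemidef_of_tendsto
      (fun i => Smoluchowski.posSemidef_sigmaH hYm (hBm i) (hBfin i) (hB0 i) t) hS
    have hXm := fun i => (hsys i).measurable_normalizedCount (hBm i) t
    refine ⟨hSpsd, fun i => (hXm i).aemeasurable, aemeasurable_id, ?_⟩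
    -- Lévy's theorem concerns sequences and `l` is arbitrary. The coarsest filter along which `ρ →
    -- ∞` and `Σ_H → S` is countably generated and contains all that the argument needs, so
    -- convergence is proved along it and passed to `l ≤ m`.
    set m := comap (fun i => Smoluchowski.rho (lam i) (B i)) atTop ⊓
      comap (fun i => Smoluchowski.sigmaH P' Y (B i) t) (𝓝 S) with hm
    have : FirstCountableTopology (Matrix (Fin n) (Fin n) ℝ) :=
      inferInstanceAs (FirstCountableTopology (Fin n → Fin n → ℝ))
    have : m.IsCountablyGenerated := Filter.Inf.isCountablyGenerated _ _
    have hlm : l ≤ m := le_inf hrho.le_comap hS.le_comap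
    have hrhom : Tendsto (fun i => Smoluchowski.rho (lam i) (B i)) m atTop :=
      tendsto_comap.mono_left inf_le_left
    have hSm : Tendsto (fun i => Smoluchowski.sigmaH P' Y (B i) t) m (𝓝 S) :=
      tendsto_comap.mono_left inf_le_right
    refine Smoluchowski.tendsto_probabilityMeasure_of_charFun hlm fun θ => ?_
    choose R hR hchar using fun i => (hsys i).charFun_normalizedCount hYm (hBm i) (hBfin i) (hB0 i)
      (hlam i) t θ
    have hsqrt := Real.tendsto_sqrt_atTop.comp hrhom
    have hR0 : Tendsto R m (𝓝 0) := by
      refine squeeze_zero_norm hR ?_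
      have h1 := tendsto_const_nhds (x := (∑ k, |θ k|) ^ 3) |>.div_atTop hsqrt
      have h2 := (Real.continuous_exp.tendsto _).comp
        (tendsto_const_nhds (x := ∑ k, |θ k|) |>.div_atTop hsqrt)
      simpa using h1.mul h2
    have hc : Continuous fun A : Matrix (Fin n) (Fin n) ℝ => (θ : Fin n → ℝ) ⬝ᵥ A.mulVec θ := by
      fun_prop
    have hquad := (Complex.continuous_ofReal.tendsto _).comp ((hc.tendsto S).comp hSm)
    have hlim := (Complex.continuous_exp.tendsto _).comp ((hquad.neg.div_const 2).add hR0)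
    simp only [ProbabilityMeasure.coe_mk, Measure.map_id, charFun_multivariateGaussian hSpsd]
    refine Tendsto.congr (fun i => (hchar i).symm) ?_
    convert! hlim using 2
    simp [neg_div]
  refine ⟨fun i s => (hsys i).ae_count_lt_top hYm (hBm i) (hBfin i) s, fun B₀ hB₀ => ?_, hvar⟩
  -- For a fixed region the matrices are constant, hence converge.
  refine hvar _ (tendsto_const_nhds.congr fun i => ?_)
  rw [hB₀ i]
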